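/- Let $0<\alpha\le 1$. The initial value problem $$F'(x)=1-F(x)^{\alpha}\quad (x\ge 0),\qquad F(0)=0$$ (with one-sided derivative at $x=0$) has a solution $F:[0,+\infty)\to\mathbb{R}$, and for every such solution $F=F_\alpha$ the function $\widetilde F_\alpha(x)=1-F_\alpha(x)$ satisfies $$\widetilde F_\alpha(x)\,\widetilde F_\alpha(y)\le \widetilde F_\alpha(x+y)\qquad\text{for all } x,y\ge 0.$$ -/

import Mathlib

/-- `F` is a solution on the half-line `[0, ∞)` of the initial value problem
`F'(x) = 1 - F(x) ^ α`, `F(0) = 0` (the derivative at `0` is the one-sided one).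
For `α > 0` such an `F` is automatically nonnegative on `[0, ∞)`: `F' = 1` wherever `F` vanishes,
so `F` cannot cross zero downwards. Hence only real powers of nonnegative numbers occur. -/
structure IsProfileFunction (α : ℝ) (F : ℝ → ℝ) : Prop where
  map_zero : F 0 = 0
  hasDerivWithinAt : ∀ x : ℝ, 0 ≤ x → HasDerivWithinAt F (1 - F x ^ α) (Set.Ici 0) x

open Set Filter Topology

/-! With `G = 1 - F`, the ratio `G (t + y) / G t` is nondecreasing in `t ≥ 0`; comparing `t = 0`
with `t = x` gives the claim. Its logarithmic derivative is `φ (F t) - φ (F (t + y))`, where `φ a =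
(1 - a ^ α) / (1 - a)` decreases by concavity (`one_sub_rpow_mul_le`) and `F` increases with values
in `[0, 1)`. Existence comes from the substitution `F = 1 - exp (-w)`, which leads to an equation
solvable by separation of variables. -/

/-- The chord slope from `a` to `1` of the concave function `t ↦ t ^ α` decreases in `a`. -/
theorem one_sub_rpow_mul_le {α : ℝ} (hα₀ : 0 < α) (hα₁ : α ≤ 1) {a b : ℝ} (ha : 0 ≤ a)
    (hab : a ≤ b) (hb : b < 1) : (1 - b ^ α) * (1 - a) ≤ (1 - a ^ α) * (1 - b) := by
  have h1a : 0 < 1 - a := by linarith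
  have h := (Real.concaveOn_rpow hα₀.le hα₁).2 (mem_Ici.2 ha) (mem_Ici.2 zero_le_one)
    (div_nonneg (by linarith : 0 ≤ 1 - b) h1a.le) (div_nonneg (by linarith : 0 ≤ b - a) h1a.le)
    (by field_simp; ring)
  have hcomb : (1 - b) / (1 - a) * a + (b - a) / (1 - a) * 1 = b := by field_simp; ring
  simp only [smul_eq_mul, hcomb, Real.one_rpow] at h
  have h' : (1 - b) * a ^ α + (b - a) ≤ b ^ α * (1 - a) := by
    have := mul_le_mul_of_nonneg_right h h1a.le
    have heq : ((1 - b) / (1 - a) * a ^ α + (b - a) / (1 - a) * 1) * (1 - a)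
        = (1 - b) * a ^ α + (b - a) := by field_simp
    linarith
  linarith

theorem le_rpow_of_le_one {α : ℝ} (hα₁ : α ≤ 1) {u : ℝ} (hu₀ : 0 ≤ u)
    (hu₁ : u ≤ 1) : u ≤ u ^ α := by
  simpa using Real.rpow_le_rpow_of_exponent_ge_of_imp hu₀ hu₁ hα₁ (fun _ h => absurd h one_ne_zero)

namespace IsProfileFunction

variable {α : ℝ} {F : ℝ → ℝ}

theorem continuousOn (hF : IsProfileFunction α F) : ContinuousOn F (Ici 0) :=
  fun x hx => (hF.hasDerivWithinAt x hx).continuousWithinAt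

theorem hasDerivAt (hF : IsProfileFunction α F) {x : ℝ} (hx : 0 < x) :
    HasDerivAt F (1 - F x ^ α) x :=
  (hF.hasDerivWithinAt x hx.le).hasDerivAt (Ici_mem_nhds hx)

theorem hasDerivWithinAt_Ici (hF : IsProfileFunction α F) {x : ℝ} (hx : 0 ≤ x) :
    HasDerivWithinAt F (1 - F x ^ α) (Ici x) x :=
  (hF.hasDerivWithinAt x hx).mono (Ici_subset_Ici.2 hx)

theorem nonneg (hF : IsProfileFunction α F) (hα₀ : 0 < α) {x : ℝ} (hx : 0 ≤ x) : 0 ≤ F x := by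
  have := image_le_of_deriv_right_lt_deriv_boundary (f := fun t => -F t)
    (f' := fun t => -(1 - F t ^ α)) (a := 0) (b := x) (B := fun _ => 0) (B' := fun _ => 0)
    (hF.continuousOn.mono Icc_subset_Ici_self).neg
    (fun t ht => (hF.hasDerivWithinAt_Ici ht.1).neg) (by simp [hF.map_zero])
    (fun t => hasDerivAt_const t 0)
    (fun t _ h => by
      have : F t = 0 := neg_eq_zero.1 h
      simp [this, Real.zero_rpow hα₀.ne'])
    (right_mem_Icc.2 hx)
  simpa using this

theorem lt_one (hF : IsProfileFunction α F) (hα₀ : 0 < α) (hα₁ : α ≤ 1) {x : ℝ} (hx : 0 ≤ x) :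
    F x < 1 := by
  -- Barrier below `1`. The factor `2` makes the comparison strict: at contact `F' = 1 - F ^ α ≤ 1 -
  -- F = exp (-2t) < 2 exp (-2t)`.
  have hB : ∀ t : ℝ, HasDerivAt (fun t : ℝ => 1 - Real.exp (-(2 * t)))
      (2 * Real.exp (-(2 * t))) t := fun t => by
    have := (((hasDerivAt_id t).const_mul 2).neg.exp).const_sub 1
    refine this.congr_deriv ?_
    simp only [id, mul_one, Pi.neg_apply]
    ring
  have := image_le_of_deriv_right_lt_deriv_boundary (a := 0) (b := x)
    (hF.continuousOn.mono Icc_subset_Ici_self)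
    (fun t ht => hF.hasDerivWithinAt_Ici ht.1) (by simp [hF.map_zero]) hB
    (fun t ht h => by
      have hpos := Real.exp_pos (-(2 * t))
      have := le_rpow_of_le_one hα₁ (hF.nonneg hα₀ ht.1) (by linarith)
      linarith)
    (right_mem_Icc.2 hx)
  have hpos := Real.exp_pos (-(2 * x))
  linarith

theorem monotoneOn (hF : IsProfileFunction α F) (hα₀ : 0 < α) (hα₁ : α ≤ 1) :
    MonotoneOn F (Ici 0) := by
  refine monotoneOn_of_hasDerivWithinAt_nonneg (convex_Ici 0) hF.continuousOn
    (f' := fun x => 1 - F x ^ α) (fun x hx => ?_) (fun x hx => ?_) <;>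
    rw [interior_Ici] at hx
  · exact (hF.hasDerivAt hx).hasDerivWithinAt
  · exact sub_nonneg.2 (Real.rpow_le_one (hF.nonneg hα₀ (le_of_lt hx))
      (hF.lt_one hα₀ hα₁ (le_of_lt hx)).le hα₀.le)

theorem one_sub_mul_one_sub_le (hF : IsProfileFunction α F) (hα₀ : 0 < α) (hα₁ : α ≤ 1)
    {x y : ℝ} (hx : 0 ≤ x) (hy : 0 ≤ y) : (1 - F x) * (1 - F y) ≤ 1 - F (x + y) := by
  have hpos : ∀ t, 0 ≤ t → 0 < 1 - F t := fun t ht => sub_pos.2 (hF.lt_one hα₀ hα₁ ht)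
  have hmono : MonotoneOn (fun t => (1 - F (t + y)) / (1 - F t)) (Ici 0) := by
    refine monotoneOn_of_hasDerivWithinAt_nonneg (convex_Ici 0)
      (f' := fun t => (-(1 - F (t + y) ^ α) * (1 - F t) - (1 - F (t + y)) * -(1 - F t ^ α))
        / (1 - F t) ^ 2) ?_ (fun t ht => ?_) (fun t ht => ?_)
    · refine ContinuousOn.div (continuousOn_const.sub (hF.continuousOn.comp (by fun_prop) ?_))
        (continuousOn_const.sub hF.continuousOn) (fun t ht => (hpos t ht).ne')
      exact fun t ht => add_nonneg ht hy
    · rw [interior_Ici] at ht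
      have ht' : 0 < t := ht
      exact ((((hF.hasDerivAt (by linarith : 0 < t + y)).comp_add_const t y).const_sub 1).div
        ((hF.hasDerivAt ht').const_sub 1) (hpos t ht'.le).ne').hasDerivWithinAt
    · rw [interior_Ici] at ht
      have ht' : 0 ≤ t := le_of_lt ht
      have hty : 0 ≤ t + y := add_nonneg ht' hy
      have := one_sub_rpow_mul_le hα₀ hα₁ (hF.nonneg hα₀ ht')
        (hF.monotoneOn hα₀ hα₁ ht' hty (by linarith)) (hF.lt_one hα₀ hα₁ hty)
      exact div_nonneg (by linarith) (sq_nonneg _)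
  have h := hmono self_mem_Ici hx hx
  simp only [zero_add, hF.map_zero, sub_zero, div_one] at h
  rw [le_div_iff₀ (hpos x hx)] at h
  linarith

end IsProfileFunction

/-- An autonomous equation `w' = k w` with `k` continuous and `0 < k ≤ 1` has a global solution
through the origin, nonnegative at positive times. -/
theorem exists_hasDerivAt_eq_comp {k : ℝ → ℝ} (hk : Continuous k) (hpos : ∀ w, 0 < k w)
    (hle : ∀ w, k w ≤ 1) :
    ∃ w : ℝ → ℝ, w 0 = 0 ∧ Monotone w ∧ ∀ x, HasDerivAt w (k (w x)) x := by
  have hc : Continuous fun v => (k v)⁻¹ := hk.inv₀ fun v => (hpos v).ne'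
  -- `S v` is the time at which the solution reaches `v`. Since `1 / k ≥ 1`, `S` grows at least as
  -- fast as the identity, so it is a bijection of `ℝ`, and its inverse is the solution.
  set S : ℝ → ℝ := fun v => ∫ t in (0 : ℝ)..v, (k t)⁻¹ with hS
  have hS0 : S 0 = 0 := by simp [hS]
  have hder : ∀ v, HasDerivAt S (k v)⁻¹ v := fun v => hc.integral_hasStrictDerivAt 0 v |>.hasDerivAt
  have hmono : StrictMono S := strictMono_of_hasDerivAt_pos hder fun v => inv_pos.2 (hpos v)
  have hcont : Continuous S := continuous_iff_continuousAt.2 fun v => (hder v).continuousAt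
  have hexp : Monotone fun v => S v - v :=
    monotone_of_hasDerivAt_nonneg (fun v => (hder v).sub (hasDerivAt_id v))
      fun v => sub_nonneg.2 ((one_le_inv₀ (hpos v)).2 (hle v))
  have htop : Tendsto S atTop atTop :=
    tendsto_atTop_mono' _ ((eventually_ge_atTop 0).mono fun v hv => by
      have := hexp hv; simp only [hS0] at this; simp only [id]; linarith) tendsto_id
  have hbot : Tendsto S atBot atBot :=
    tendsto_atBot_mono' _ ((eventually_le_atBot 0).mono fun v hv => by
      have := hexp hv; simp only [hS0] at this; simp only [id]; linarith) tendsto_id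
  let e := hmono.orderIsoOfSurjective S (hcont.surjective htop hbot)
  have he : ∀ v, e v = S v := fun _ => rfl
  refine ⟨e.symm, ?_, e.symm.monotone, fun x => ?_⟩
  · rw [OrderIso.symm_apply_eq, he, hS0]
  · have := (hder (e.symm x)).of_local_left_inverse e.symm.continuous.continuousAt
      (inv_pos.2 (hpos _)).ne' (Eventually.of_forall fun y => e.apply_symm_apply y)
    rwa [inv_inv] at this

/-- The solution is `1 - exp (-w)`, where `w` solves an equation with a positive bounded
right-hand side. -/
theorem exists_isProfileFunction {α : ℝ} (hα₀ : 0 < α) (hα₁ : α ≤ 1) :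
    ∃ F : ℝ → ℝ, IsProfileFunction α F := by
  have hlt : ∀ v : ℝ, max 0 (1 - Real.exp (-v)) < 1 := fun v =>
    max_lt one_pos (by linarith [Real.exp_pos (-v)])
  obtain ⟨w, hw0, hmono, hw⟩ := exists_hasDerivAt_eq_comp
    -- The truncation by `max 0` keeps the base of the power nonnegative for `v < 0`; it is inactive
    -- for `x ≥ 0`, where `w x ≥ 0`.
    (k := fun v => (1 - max 0 (1 - Real.exp (-v)) ^ α) * Real.exp v)
    ((continuous_const.sub (Continuous.rpow_const (by fun_prop) fun _ => Or.inr hα₀.le)).mul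
      Real.continuous_exp)
    (fun v => mul_pos (sub_pos.2 (Real.rpow_lt_one (le_max_left _ _) (hlt v) hα₀))
      (Real.exp_pos v))
    (fun v => by
      have h1 := le_rpow_of_le_one hα₁ (le_max_left _ _) (hlt v).le
      have h2 := le_max_right 0 (1 - Real.exp (-v))
      calc _ ≤ Real.exp (-v) * Real.exp v :=
            mul_le_mul_of_nonneg_right (by linarith) (Real.exp_pos v).le
        _ = 1 := by rw [← Real.exp_add, neg_add_cancel, Real.exp_zero])
  refine ⟨fun x => 1 - Real.exp (-w x), by simp [hw0], fun x hx => ?_⟩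
  have hwx : 0 ≤ w x := hw0 ▸ hmono hx
  have hnonneg : 0 ≤ 1 - Real.exp (-w x) := sub_nonneg.2 (Real.exp_le_one_iff.2 (by linarith))
  have h := ((hw x).neg.exp.const_sub 1).hasDerivWithinAt (s := Ici 0)
  refine h.congr_deriv ?_
  have hexp : Real.exp (-w x) * Real.exp (w x) = 1 := by
    rw [← Real.exp_add, neg_add_cancel, Real.exp_zero]
  simp only [max_eq_right hnonneg, Pi.neg_apply]
  linear_combination (1 - (1 - Real.exp (-w x)) ^ α) * hexp

theorem corollary4p3 (α : ℝ) (hα₀ : 0 < α) (hα₁ : α ≤ 1) :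
    (∃ F : ℝ → ℝ, IsProfileFunction α F) ∧
      ∀ F : ℝ → ℝ, IsProfileFunction α F →
        ∀ x y : ℝ, 0 ≤ x → 0 ≤ y → (1 - F x) * (1 - F y) ≤ 1 - F (x + y) :=
  ⟨exists_isProfileFunction hα₀ hα₁,
    fun _ hF _ _ hx hy => hF.one_sub_mul_one_sub_le hα₀ hα₁ hx hy⟩
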